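/- Let $n,m,k$ be natural numbers and, for $i=1,2$, let $S_i$ be the linear control system $\dot x(t)=A_ix(t)+B_iu(t)$, $y(t)=C_ix(t)+G_iu(t)$, with $A_i\in\mathbb R^{n\times n}$, $B_i\in\mathbb R^{n\times m}$, $C_i\in\mathbb R^{k\times n}$, $G_i\in\mathbb R^{k\times m}$. For $T>0$, $S_1$ and $S_2$ are called distinguishable on $[0,T]$ if for every nonzero $(x_{10},x_{20},u)\in\mathbb R^n\times\mathbb R^n\times L^1(0,T;\mathbb R^m)$ the outputs $y_1$ of $S_1$ (with $x(0)=x_{10}$ and input $u$) and $y_2$ of $S_2$ (with $x(0)=x_{20}$ and input $u$) are not identical (almost everywhere) on $[0,T]$. Put $$A=\begin{pmatrix}A_1&0\\0&A_2\end{pmatrix},\quad B=\begin{pmatrix}B_1\\B_2\end{pmatrix},\quad C=\begin{pmatrix}C_1&-C_2\end{pmatrix},\quad G=G_1-G_2 .$$ Suppose that, for some $T>0$, $S_1$ and $S_2$ are not distinguishable on $[0,T]$. Then there are $\lambda\in\mathbb C$, $\xi\in\mathbb C^m$ and $X_0\in\mathbb C^{2n}$ such that, with $u(t)=e^{\lambda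 t}\xi$, the pair $(X_0,u)$ is nonzero and $$Ce^{At}X_0+C\int_0^te^{A(t-s)}Bu(s)\,ds+Gu(t)=0\qquad\text{for all }t\ge 0 .$$ -/

import Mathlib

open MeasureTheory

/-- The time-invariant linear control system `x' = A x + B u`, `y = C x + G u`, with state in
`ℝⁿ`, input in `ℝᵐ` and output in `ℝᵏ`, given by its four real matrices. -/
structure LinSys (n m k : ℕ) where
  A : Matrix (Fin n) (Fin n) ℝ
  B : Matrix (Fin n) (Fin m) ℝ
  C : Matrix (Fin k) (Fin n) ℝ
  G : Matrix (Fin k) (Fin m) ℝ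

namespace LinSys

open scoped Matrix

variable {n m k : ℕ}

/-- The space `L¹(0,T;ℝᵐ)` of inputs. -/
abbrev InputL1 (m : ℕ) (T : ℝ) : Type :=
  Lp (Fin m → ℝ) 1 ((volume : Measure ℝ).restrict (Set.Icc 0 T))

/-- `x` is the (Carathéodory) solution on `[0,T]` of `x' = A x + B u`, `x(0) = x₀`:
it is continuous on `[0,T]` and satisfies the integrated equation there. -/
def IsSolution (S : LinSys n m k) (T : ℝ) (x₀ : Fin n → ℝ) (u : ℝ → Fin m → ℝ)
    (x : ℝ → Fin n → ℝ) : Prop :=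
  ContinuousOn x (Set.Icc 0 T) ∧
    ∀ t ∈ Set.Icc 0 T, x t = x₀ + ∫ s in (0 : ℝ)..t, (S.A *ᵥ x s + S.B *ᵥ u s)

/-- The output `y = C x + G u`. -/
def output (S : LinSys n m k) (x : ℝ → Fin n → ℝ) (u : ℝ → Fin m → ℝ) (t : ℝ) : Fin k → ℝ :=
  S.C *ᵥ x t + S.G *ᵥ u t

/-- `S₁` and `S₂` are distinguishable on `[0,T]`: for every nonzero
`(x₁₀, x₂₀, u) ∈ ℝⁿ × ℝⁿ × L¹(0,T;ℝᵐ)` the corresponding outputs are not identical on `[0,T]`.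
As `u` is an `L¹` class, so are the outputs, and identity means equality almost everywhere. -/
def Distinguishable (S₁ S₂ : LinSys n m k) (T : ℝ) : Prop :=
  ∀ (x₁₀ x₂₀ : Fin n → ℝ) (u : InputL1 m T), (x₁₀, x₂₀, u) ≠ 0 →
    ∀ x₁ x₂ : ℝ → Fin n → ℝ, S₁.IsSolution T x₁₀ u x₁ → S₂.IsSolution T x₂₀ u x₂ →
      ¬ (∀ᵐ t ∂(volume.restrict (Set.Icc 0 T)), S₁.output x₁ u t = S₂.output x₂ u t)

/-- `A = diag(A₁, A₂)`, regarded as a complex matrix. -/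
def diffA (S₁ S₂ : LinSys n m k) : Matrix (Fin n ⊕ Fin n) (Fin n ⊕ Fin n) ℂ :=
  (Matrix.fromBlocks S₁.A 0 0 S₂.A).map Complex.ofReal

/-- `B = (B₁ ; B₂)` (stacked), regarded as a complex matrix. -/
def diffB (S₁ S₂ : LinSys n m k) : Matrix (Fin n ⊕ Fin n) (Fin m) ℂ :=
  (Matrix.fromRows S₁.B S₂.B).map Complex.ofReal

/-- `C = (C₁, -C₂)` (side by side), regarded as a complex matrix. -/
def diffC (S₁ S₂ : LinSys n m k) : Matrix (Fin k) (Fin n ⊕ Fin n) ℂ :=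
  (Matrix.fromCols S₁.C (-S₂.C)).map Complex.ofReal

/-- `G = G₁ - G₂`, regarded as a complex matrix. -/
def diffG (S₁ S₂ : LinSys n m k) : Matrix (Fin k) (Fin m) ℂ :=
  (S₁.G - S₂.G).map Complex.ofReal

/-- The output difference
`Y(t) = C e^{At} X₀ + C ∫₀ᵗ e^{A(t-s)} B u(s) ds + G u(t)`
for a complex initial state `X₀` and a complex input `u`. -/
noncomputable def outputDiff (S₁ S₂ : LinSys n m k) (X₀ : Fin n ⊕ Fin n → ℂ)
    (u : ℝ → Fin m → ℂ) (t : ℝ) : Fin k → ℂ :=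
  diffC S₁ S₂ *ᵥ (NormedSpace.exp ((t : ℂ) • diffA S₁ S₂) *ᵥ X₀)
    + diffC S₁ S₂ *ᵥ (∫ s in (0 : ℝ)..t,
        NormedSpace.exp (((t - s : ℝ) : ℂ) • diffA S₁ S₂) *ᵥ (diffB S₁ S₂ *ᵥ u s))
    + diffG S₁ S₂ *ᵥ u t

end LinSys

open Polynomial in
/-- On a simple `ℂ[X]`-module the variable acts as a scalar. -/
theorem exists_X_smul_eq_C_smul (S : Type*) [AddCommGroup S] [Module ℂ[X] S]
    [IsSimpleModule ℂ[X] S] : ∃ c : ℂ, ∀ s : S, (X : ℂ[X]) • s = (C c : ℂ[X]) • s := by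
  have hmax : (Module.annihilator ℂ[X] S).IsMaximal := IsSimpleModule.annihilator_isMaximal
  obtain ⟨p, hp⟩ := IsPrincipalIdealRing.principal (Module.annihilator ℂ[X] S)
  have hpu : ¬ IsUnit p := fun hu => hmax.ne_top (by
    rw [hp]; exact Ideal.span_singleton_eq_top.2 hu)
  obtain ⟨c, hc⟩ : ∃ c, p.IsRoot c := by
    by_cases h0 : p = 0
    · exact ⟨0, by simp [h0]⟩
    · refine IsAlgClosed.exists_root p fun hd => hpu ?_
      exact isUnit_iff_degree_eq_zero.2 hd
  refine ⟨c, fun s => ?_⟩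
  have hle : Module.annihilator ℂ[X] S ≤ Ideal.span {X - C c} := by
    rw [hp]
    exact Ideal.span_singleton_le_span_singleton.2 (dvd_iff_isRoot.2 hc)
  have hne : Ideal.span {X - C c} ≠ ⊤ := fun h =>
    not_isUnit_X_sub_C c (Ideal.span_singleton_eq_top.1 h)
  have hmem : X - C c ∈ Module.annihilator ℂ[X] S := by
    rw [hmax.eq_of_le hne hle]
    exact Ideal.mem_span_singleton_self _
  have := Module.mem_annihilator.1 hmem s
  rwa [sub_smul, sub_eq_zero] at this

open Polynomial in
/-- If finitely many vectors, not all zero, satisfy linear relations involving an endomorphism `F`,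
then some nonzero complex tuple satisfies the same relations with `F` replaced by a scalar. -/
theorem exists_scalar_solution {V ι : Type*} [AddCommGroup V] [Module ℂ V] [Fintype ι]
    (F : V →ₗ[ℂ] V) (z : ι → V) (hz : z ≠ 0) :
    ∃ (c : ℂ) (ζ : ι → ℂ), ζ ≠ 0 ∧
      (∀ i (b : ι → ℂ), F (z i) = ∑ j, b j • z j → c * ζ i = ∑ j, b j * ζ j) ∧
      (∀ b : ι → ℂ, ∑ j, b j • z j = 0 → ∑ j, b j * ζ j = 0) := by
  let W := Module.AEval' F
  let w : ι → W := fun i => Module.AEval'.of F (z i)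
  let N : Submodule ℂ[X] W := Submodule.span ℂ[X] (Set.range w)
  have : Module.Finite ℂ[X] N := Module.Finite.span_of_finite _ (Set.finite_range w)
  let v : ι → N := fun i => ⟨w i, Submodule.subset_span ⟨i, rfl⟩⟩
  have hv : ∀ K : Submodule ℂ[X] N, (∀ i, v i ∈ K) → K = ⊤ := by
    intro K hK
    rw [eq_top_iff, ← Submodule.map_le_map_iff_of_injective N.injective_subtype]
    rw [Submodule.map_subtype_top]
    refine Submodule.span_le.2 ?_
    rintro _ ⟨i, rfl⟩
    exact ⟨v i, hK i, rfl⟩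
  have : Nontrivial N := by
    obtain ⟨i, hi⟩ := Function.ne_iff.1 hz
    refine ⟨v i, 0, fun h => hi ?_⟩
    have h2 : w i = 0 := congrArg Subtype.val h
    exact (Module.AEval'.of F).map_eq_zero_iff.1 h2
  obtain ⟨K, hK, -⟩ := (eq_top_or_exists_le_coatom (⊥ : Submodule ℂ[X] N)).resolve_left bot_ne_top
  have : IsSimpleModule ℂ[X] (N ⧸ K) := isSimpleModule_iff_isCoatom.2 hK
  obtain ⟨c, hc⟩ := exists_X_smul_eq_C_smul (N ⧸ K)
  obtain ⟨i₀, hi₀⟩ : ∃ i, K.mkQ (v i) ≠ 0 := by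
    by_contra! h
    exact hK.1 (hv K fun i => by simpa using h i)
  obtain ⟨f, hf⟩ := Module.Projective.exists_dual_ne_zero ℂ hi₀
  have hC : ∀ (a : ℂ) (s : N ⧸ K), (C a : ℂ[X]) • s = a • s := fun a s => by
    rw [← algebraMap_eq, algebraMap_smul]
  have hsum : ∀ b : ι → ℂ, f (K.mkQ (∑ j, (C (b j) : ℂ[X]) • v j))
      = ∑ j, b j * f (K.mkQ (v j)) := by
    intro b
    simp only [map_sum, map_smul, hC, smul_eq_mul]
  have hval : ∀ b : ι → ℂ, ((∑ j, (C (b j) : ℂ[X]) • v j : N) : W)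
      = Module.AEval'.of F (∑ j, b j • z j) := by
    intro b
    simp only [AddSubmonoidClass.coe_finsetSum, Submodule.coe_smul, map_sum, map_smul]
    refine Finset.sum_congr rfl fun j _ => ?_
    exact Module.AEval.C_smul _ _ _
  refine ⟨c, fun i => f (K.mkQ (v i)), fun h => hf (congrFun h i₀), ?_, ?_⟩
  · intro i b h
    rw [← hsum, ← smul_eq_mul, ← map_smul, ← hC, ← hc, ← map_smul]
    congr 2
    apply Subtype.ext
    rw [hval, ← h]
    exact Module.AEval'.X_smul_of _ _
  · intro b h
    rw [← hsum]
    have : (∑ j, (C (b j) : ℂ[X]) • v j : N) = 0 := by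
      apply Subtype.ext
      rw [hval, h, map_zero]; rfl
    rw [this, map_zero, map_zero]

open scoped Matrix in
attribute [local instance] Matrix.linftyOpNormedRing Matrix.linftyOpNormedAlgebra in
/-- Variation of constants for the exponential input `e^{ct} w`, when `A x + w = c x`. -/
theorem exp_mulVec_add_integral {ι : Type*} [Fintype ι] [DecidableEq ι] (A : Matrix ι ι ℂ)
    (x w : ι → ℂ) (c : ℂ) (h : A *ᵥ x + w = c • x) (t : ℝ) :
    NormedSpace.exp ((t : ℂ) • A) *ᵥ x
      + ∫ s in (0 : ℝ)..t, NormedSpace.exp (((t - s : ℝ) : ℂ) • A) *ᵥ (Complex.exp (c * s) • w)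
      = Complex.exp (c * t) • x := by
  have hE : ∀ s : ℝ, HasDerivAt (fun s : ℝ => NormedSpace.exp (((t - s : ℝ) : ℂ) • A))
      (-(NormedSpace.exp (((t - s : ℝ) : ℂ) • A) * A)) s := by
    intro s
    have h1 := hasDerivAt_exp_smul_const (𝕂 := ℂ) A ((t - s : ℝ) : ℂ)
    have h2 : HasDerivAt (fun s : ℝ => ((t - s : ℝ) : ℂ)) (-1) s := by
      simpa using ((hasDerivAt_id s).const_sub t).ofReal_comp
    have h3 := h1.scomp s h2
    rw [neg_one_smul] at h3
    exact h3
  have hexp : ∀ s : ℝ, HasDerivAt (fun s : ℝ => Complex.exp (c * s)) (c * Complex.exp (c * s)) s := by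
    intro s
    have h2 : HasDerivAt (fun s : ℝ => c * (s : ℂ)) c s := by
      simpa using (Complex.ofRealCLM.hasDerivAt (x := s)).const_mul c
    simpa [mul_comm] using h2.cexp
  have hL : ∀ (M : ℝ → Matrix ι ι ℂ) (M' : Matrix ι ι ℂ) (y : ι → ℂ) (s : ℝ), HasDerivAt M M' s →
      HasDerivAt (fun s => M s *ᵥ y) (M' *ᵥ y) s := by
    intro M M' y s hM
    let L : Matrix ι ι ℂ →ₗ[ℝ] (ι → ℂ) :=
      { toFun := fun N => N *ᵥ y
        map_add' := fun N N' => Matrix.add_mulVec N N' y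
        map_smul' := fun r N => Matrix.smul_mulVec r N y }
    exact (LinearMap.toContinuousLinearMap L).hasFDerivAt.comp_hasDerivAt s hM
  have hder : ∀ s : ℝ, HasDerivAt
      (fun s : ℝ => Complex.exp (c * s) • (NormedSpace.exp (((t - s : ℝ) : ℂ) • A) *ᵥ x))
      (NormedSpace.exp (((t - s : ℝ) : ℂ) • A) *ᵥ (Complex.exp (c * s) • w)) s := by
    intro s
    refine ((hexp s).smul (hL _ _ x s (hE s))).congr_deriv ?_
    rw [eq_sub_of_add_eq' h]
    simp only [Matrix.neg_mulVec, Matrix.mulVec_smul, Matrix.mulVec_sub, Matrix.mulVec_mulVec,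
      smul_sub, smul_neg, smul_smul]
    rw [mul_comm (Complex.exp _) c]
    abel
  have hcont : Continuous fun s : ℝ =>
      NormedSpace.exp (((t - s : ℝ) : ℂ) • A) *ᵥ (Complex.exp (c * s) • w) := by
    refine Continuous.matrix_mulVec ?_ ?_
    · exact continuous_iff_continuousAt.2 fun s => (hE s).continuousAt
    · fun_prop
  rw [intervalIntegral.integral_eq_sub_of_hasDerivAt (fun s _ => hder s)
    (hcont.intervalIntegrable _ _)]
  simp

open scoped ContDiff in
/-- Smooth functions with compact support inside the open interval `(0,T)`. -/
def IntervalTest (T : ℝ) : Type :=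
  {φ : ℝ → ℝ // ContDiff ℝ ∞ φ ∧ tsupport φ ⊆ Set.Ioo 0 T}

namespace IntervalTest

variable {T : ℝ}

/-- The derivative of a test function. -/
noncomputable def derivative (φ : IntervalTest T) : IntervalTest T :=
  ⟨deriv φ.1, (contDiff_infty_iff_deriv.1 φ.2.1).2,
    (closure_minimal support_deriv_subset (isClosed_tsupport _)).trans φ.2.2⟩

/-- Minus the transpose of differentiation, acting on functionals on test functions. -/
noncomputable def weakDeriv (T : ℝ) : (IntervalTest T → ℂ) →ₗ[ℂ] (IntervalTest T → ℂ) :=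
  -LinearMap.funLeft ℂ ℂ derivative

/-- The functional on test functions given by integration against `f`. -/
noncomputable def pairing (T : ℝ) (f : ℝ → ℝ) (φ : IntervalTest T) : ℂ :=
  ((∫ t in (0 : ℝ)..T, φ.1 t * f t : ℝ) : ℂ)

theorem intervalIntegrable_mul (φ : IntervalTest T) {f : ℝ → ℝ}
    (hf : IntervalIntegrable f volume 0 T) :
    IntervalIntegrable (fun t => φ.1 t * f t) volume 0 T :=
  hf.continuousOn_mul φ.2.1.continuous.continuousOn

theorem sum_smul_pairing {ι : Type*} [Fintype ι] (b : ι → ℝ) (y : ι → ℝ → ℝ)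
    (hy : ∀ i, IntervalIntegrable (y i) volume 0 T) :
    ∑ j, (b j : ℂ) • pairing T (y j) = pairing T fun t => ∑ j, b j * y j t := by
  funext φ
  simp only [Finset.sum_apply, Pi.smul_apply, pairing, smul_eq_mul, Finset.mul_sum]
  rw [intervalIntegral.integral_finsetSum]
  · push_cast
    refine Finset.sum_congr rfl fun j _ => ?_
    rw [← Complex.ofReal_mul, ← intervalIntegral.integral_const_mul]
    congr 2
    funext t
    ring
  · intro j _
    convert (φ.intervalIntegrable_mul (hy j)).const_mul (b j) using 2
    ring

theorem weakDeriv_pairing (hT : 0 ≤ T) {f g : ℝ → ℝ} {a : ℝ}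
    (hg : IntervalIntegrable g volume 0 T)
    (hf : ∀ t ∈ Set.Icc 0 T, f t = a + ∫ s in (0 : ℝ)..t, g s) :
    weakDeriv T (pairing T f) = pairing T g := by
  funext φ
  have h0 : φ.1 0 = 0 := image_eq_zero_of_notMem_tsupport fun h => lt_irrefl _ (φ.2.2 h).1
  have h1 : φ.1 T = 0 := image_eq_zero_of_notMem_tsupport fun h => lt_irrefl _ (φ.2.2 h).2
  have hφ : AbsolutelyContinuousOnInterval φ.1 0 T :=
    ContDiffOn.absolutelyContinuousOnInterval (φ.2.1.of_le (by norm_num)).contDiffOn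
  have hG : AbsolutelyContinuousOnInterval (fun t => ∫ s in (0 : ℝ)..t, g s) 0 T :=
    hg.absolutelyContinuousOnInterval_intervalIntegral (by simp)
  have hparts := hφ.integral_mul_deriv_eq_deriv_mul hG
  have hd : ∫ t in (0 : ℝ)..T, φ.1 t * deriv (fun t => ∫ s in (0 : ℝ)..t, g s) t
      = ∫ t in (0 : ℝ)..T, φ.1 t * g t := by
    apply intervalIntegral.integral_congr_ae
    filter_upwards [hg.ae_hasDerivAt_integral] with t ht ht'
    rw [(ht (Set.uIoc_subset_uIcc ht') 0 (by simp)).deriv]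
  have hc : ∫ t in (0 : ℝ)..T, deriv φ.1 t = 0 := by
    rw [hφ.integral_deriv_eq_sub, h0, h1, sub_zero]
  have hsplit : ∫ t in (0 : ℝ)..T, deriv φ.1 t * f t
      = ∫ t in (0 : ℝ)..T, (deriv φ.1 t * a + deriv φ.1 t * ∫ s in (0 : ℝ)..t, g s) := by
    apply intervalIntegral.integral_congr
    intro t ht
    rw [Set.uIcc_of_le hT] at ht
    simp only [hf t ht, mul_add]
  rw [intervalIntegral.integral_add (hφ.intervalIntegrable_deriv.mul_const a)
    (hφ.intervalIntegrable_deriv.mul_continuousOn hG.continuousOn),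
    intervalIntegral.integral_mul_const, hc] at hsplit
  rw [hd, h0, h1] at hparts
  change -(((∫ t in (0 : ℝ)..T, deriv φ.1 t * f t : ℝ)) : ℂ) = _
  rw [pairing, ← Complex.ofReal_neg]
  congr 1
  linarith

theorem pairing_congr_ae {f g : ℝ → ℝ} (hT : 0 ≤ T)
    (h : ∀ᵐ t ∂(volume.restrict (Set.Icc 0 T)), f t = g t) : pairing T f = pairing T g := by
  funext φ
  rw [pairing, pairing]
  congr 1
  rw [intervalIntegral.integral_of_le hT, intervalIntegral.integral_of_le hT]
  apply integral_congr_ae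
  filter_upwards [ae_restrict_of_ae_restrict_of_subset Set.Ioc_subset_Icc_self h] with t ht
  rw [ht]

theorem ae_eq_zero_of_pairing_eq_zero (hT : 0 ≤ T) {f : ℝ → ℝ}
    (hf : IntegrableOn f (Set.Icc 0 T)) (h : pairing T f = 0) :
    ∀ᵐ t ∂(volume.restrict (Set.Icc 0 T)), f t = 0 := by
  have hU := isOpen_Ioo.ae_eq_zero_of_integral_contDiff_smul_eq_zero (U := Set.Ioo 0 T)
    (μ := volume) (f := f) (hf.mono_set Set.Ioo_subset_Icc_self).locallyIntegrableOn ?_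
  · rw [restrict_Ioo_eq_restrict_Icc.symm]
    exact (ae_restrict_iff' measurableSet_Ioo).2 hU
  · intro φ hφ _ hs
    have : ∫ t in (0 : ℝ)..T, φ t * f t = 0 :=
      Complex.ofReal_eq_zero.1 (congrFun h ⟨φ, hφ, hs⟩)
    rw [← this, intervalIntegral.integral_of_le hT, ← integral_Icc_eq_integral_Ioc,
      setIntegral_eq_integral_of_forall_compl_eq_zero]
    · rfl
    · intro t ht
      rw [image_eq_zero_of_notMem_tsupport fun h => ht (Set.Ioo_subset_Icc_self (hs h)), zero_mul]

end IntervalTest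

open scoped Matrix in
open IntervalTest in
/-- A trajectory of `x' = A x + B u` with vanishing output `C x + G u` is trivial, unless the system
pencil has a complex eigenvalue. -/
theorem exists_pencil_eigenvector_or_eq_zero {ι κ o : Type*} [Fintype ι] [Fintype κ]
    (A : Matrix ι ι ℝ) (B : Matrix ι κ ℝ) (C : Matrix o ι ℝ) (G : Matrix o κ ℝ)
    {T : ℝ} (hT : 0 < T) (x₀ : ι → ℝ) (x : ℝ → ι → ℝ) (u : ℝ → κ → ℝ)
    (hu : ∀ j, IntegrableOn (fun t => u t j) (Set.Icc 0 T))
    (hxc : ∀ i, ContinuousOn (fun t => x t i) (Set.Icc 0 T))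
    (hx : ∀ t ∈ Set.Icc 0 T, ∀ i, x t i = x₀ i + ∫ s in (0 : ℝ)..t, (A *ᵥ x s + B *ᵥ u s) i)
    (hy : ∀ᵐ t ∂(volume.restrict (Set.Icc 0 T)), C *ᵥ x t + G *ᵥ u t = 0) :
    (∃ (c : ℂ) (X : ι → ℂ) (ξ : κ → ℂ), (X ≠ 0 ∨ ξ ≠ 0) ∧
      A.map Complex.ofReal *ᵥ X + B.map Complex.ofReal *ᵥ ξ = c • X ∧
      C.map Complex.ofReal *ᵥ X + G.map Complex.ofReal *ᵥ ξ = 0) ∨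
    (x₀ = 0 ∧ ∀ᵐ t ∂(volume.restrict (Set.Icc 0 T)), u t = 0) := by
  have hT' := hT.le
  let y : ι ⊕ κ → ℝ → ℝ := Sum.elim (fun i t => x t i) (fun j t => u t j)
  have hyi : ∀ i, IntegrableOn (y i) (Set.Icc 0 T) := by
    rintro (i | j)
    · exact (hxc i).integrableOn_Icc
    · exact hu j
  have hyI : ∀ i, IntervalIntegrable (y i) volume 0 T := fun i =>
    (intervalIntegrable_iff_integrableOn_Icc_of_le hT').2 (hyi i)
  have hsum : ∀ (a : ι → ℝ) (b : κ → ℝ) (t : ℝ),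
      ∑ j, Sum.elim a b j * y j t = a ⬝ᵥ x t + b ⬝ᵥ u t := by
    intro a b t
    simp [Fintype.sum_sum_type, y, dotProduct]
  by_cases hz : (fun i => pairing T (y i)) = 0
  · right
    have hae : ∀ i, ∀ᵐ t ∂(volume.restrict (Set.Icc 0 T)), y i t = 0 := fun i =>
      ae_eq_zero_of_pairing_eq_zero hT' (hyi i) (congrFun hz i)
    constructor
    · funext i
      have h0 : x 0 i = x₀ i := by simpa using hx 0 ⟨le_rfl, hT'⟩ i
      have := Measure.eqOn_Icc_of_ae_eq volume hT.ne (hae (Sum.inl i)) (hxc i)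
        continuousOn_const ⟨le_rfl, hT'⟩
      rw [← h0]
      exact this
    · filter_upwards [ae_all_iff.2 fun j => hae (Sum.inr j)] with t ht
      funext j
      exact ht j
  · left
    obtain ⟨c, ζ, hζ, h1, h2⟩ := exists_scalar_solution (weakDeriv T) _ hz
    have hsumC : ∀ (a : ι → ℝ) (b : κ → ℝ),
        ∑ j, ((Sum.elim a b j : ℝ) : ℂ) * ζ j
          = (fun i => (a i : ℂ)) ⬝ᵥ (ζ ∘ Sum.inl) + (fun i => (b i : ℂ)) ⬝ᵥ (ζ ∘ Sum.inr) := by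
      intro a b
      simp [Fintype.sum_sum_type, dotProduct]
    refine ⟨c, ζ ∘ Sum.inl, ζ ∘ Sum.inr, ?_, ?_, ?_⟩
    · by_contra! h
      refine hζ (funext ?_)
      rintro (i | j)
      · exact congrFun h.1 i
      · exact congrFun h.2 j
    · funext i
      refine (hsumC (fun j => A i j) (fun j => B i j)).symm.trans (h1 (Sum.inl i) _ ?_).symm
      rw [sum_smul_pairing _ _ hyI]
      refine weakDeriv_pairing (a := x₀ i) hT' ?_ fun t ht => ?_
      · simpa only [Finset.sum_fn] using! IntervalIntegrable.sum Finset.univ fun j _ =>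
          (hyI j).const_mul (Sum.elim (fun j => A i j) (fun j => B i j) j)
      · simp only [hsum]
        exact hx t ht i
    · funext i
      refine (hsumC (fun j => C i j) (fun j => G i j)).symm.trans (h2 _ ?_)
      rw [sum_smul_pairing _ _ hyI, pairing_congr_ae (g := 0) hT']
      · funext φ
        simp [pairing]
      · filter_upwards [hy] with t ht
        rw [hsum]
        exact congrFun ht i

open LinSys in
open scoped Matrix in
theorem lemma3p2 {n m k : ℕ} (S₁ S₂ : LinSys n m k) (T : ℝ) (hT : 0 < T)
    (h : ¬ LinSys.Distinguishable S₁ S₂ T) :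
    ∃ (X₀ : Fin n ⊕ Fin n → ℂ) (u : ℝ → Fin m → ℂ),
      (X₀, u) ≠ 0 ∧
      (∀ t : ℝ, 0 ≤ t → LinSys.outputDiff S₁ S₂ X₀ u t = 0) ∧
      ∃ (lam : ℂ) (ξ : Fin m → ℂ), ∀ t : ℝ, u t = Complex.exp (lam * t) • ξ := by
  simp only [Distinguishable, not_forall, not_not] at h
  obtain ⟨a₁, a₂, u, hne, x₁, x₂, h₁, h₂, hy⟩ := h
  have hui : IntegrableOn (u : ℝ → Fin m → ℝ) (Set.Icc 0 T) := L1.integrable_coeFn u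
  have key : ∀ (S : LinSys n m k) (a : Fin n → ℝ) (x : ℝ → Fin n → ℝ), S.IsSolution T a u x →
      ∀ t ∈ Set.Icc 0 T, ∀ i, x t i = a i + ∫ s in (0 : ℝ)..t, (S.A *ᵥ x s + S.B *ᵥ u s) i := by
    intro S a x hS t ht i
    rw [hS.2 t ht, Pi.add_apply]
    congr 1
    have hI : IntervalIntegrable (fun s => S.A *ᵥ x s + S.B *ᵥ u s) volume 0 t := by
      rw [intervalIntegrable_iff_integrableOn_Icc_of_le ht.1]
      have hsub : Set.Icc 0 t ⊆ Set.Icc 0 T := Set.Icc_subset_Icc_right ht.2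
      refine Integrable.add ?_ ?_
      · exact ((LinearMap.toContinuousLinearMap S.A.mulVecLin).continuous.comp_continuousOn
          (hS.1.mono hsub)).integrableOn_Icc
      · exact (LinearMap.toContinuousLinearMap S.B.mulVecLin).integrable_comp (hui.mono_set hsub)
    exact ((ContinuousLinearMap.proj (R := ℝ) (φ := fun _ : Fin n => ℝ) i).intervalIntegral_comp_comm
      hI).symm
  have huc := fun j : Fin m =>
    (ContinuousLinearMap.proj (R := ℝ) (φ := fun _ : Fin m => ℝ) j).integrable_comp hui
  rcases exists_pencil_eigenvector_or_eq_zero (Matrix.fromBlocks S₁.A 0 0 S₂.A)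
    (Matrix.fromRows S₁.B S₂.B) (Matrix.fromCols S₁.C (-S₂.C)) (S₁.G - S₂.G) hT
    (Sum.elim a₁ a₂) (fun t => Sum.elim (x₁ t) (x₂ t)) u huc
    (by
      rintro (i | i)
      · exact continuousOn_pi.1 h₁.1 i
      · exact continuousOn_pi.1 h₂.1 i)
    (by
      rintro t ht (i | i)
      · simpa [Matrix.fromBlocks_mulVec, Matrix.fromRows_mulVec] using! key S₁ a₁ x₁ h₁ t ht i
      · simpa [Matrix.fromBlocks_mulVec, Matrix.fromRows_mulVec] using! key S₂ a₂ x₂ h₂ t ht i)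
    (by
      filter_upwards [hy] with t ht
      rw [output, output, ← sub_eq_zero] at ht
      rw [Matrix.fromCols_mulVec_sumElim, Matrix.sub_mulVec, Matrix.neg_mulVec, ← ht]
      abel) with
    ⟨c, X, ξ, hX, hA, hC⟩ | ⟨h0, hu0⟩
  · refine ⟨X, fun t => Complex.exp (c * t) • ξ, ?_, ?_, c, ξ, fun _ => rfl⟩
    · intro h0
      rw [Prod.mk_eq_zero] at h0
      have hξ : ξ = 0 := by simpa using congrFun h0.2 0
      exact hX.elim (fun h => h h0.1) (fun h => h hξ)
    · intro t _
      have hexp := exp_mulVec_add_integral (diffA S₁ S₂) X (diffB S₁ S₂ *ᵥ ξ) c hA t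
      simp only [outputDiff, Matrix.mulVec_smul] at hexp ⊢
      rw [← Matrix.mulVec_add, hexp, Matrix.mulVec_smul, ← smul_add]
      exact (congrArg _ hC).trans (smul_zero _)
  · exfalso
    apply hne
    have hu : u = 0 := by
      apply Lp.ext
      filter_upwards [hu0, Lp.coeFn_zero (Fin m → ℝ) 1 (volume.restrict (Set.Icc 0 T))]
        with t ht ht'
      rw [ht, ht']; rfl
    refine Prod.ext (funext fun i => congrFun h0 (Sum.inl i)) (Prod.ext (funext fun i =>
      congrFun h0 (Sum.inr i)) hu)
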